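/- Let $\mathcal G=(\mathcal V,\mathcal E)$ be a finite graph (directed or undirected, loops allowed) in which every vertex has at least one adjacent vertex, let $N\in\mathbb N$, $\gamma\in[0,1)$, $t\in\mathbb N$ and $s_p^0\in\mathcal V^N$. For a distribution (belief) $b\in\Delta(\mathcal V)$ let $G^t\langle s_p^0,b\rangle$ be the following zero-sum game between a pursuer controlling $N$ units, initially at $s_p^0$, and an evader, whose initial vertex $s_e^0$ is drawn from $b$. In every round $\tau+1\le t$ both players simultaneously move, each pursuing unit to a vertex adjacent to its current one, and the evader to a vertex adjacent to hers, giving $s_p^{\tau+1}$ and $s_e^{\tau+1}$. The game ends as soon as the evader shares a vertex with a pursuing unit; if this happens after $\tau\le t$ rounds the pursuer receives $\gamma^\tau$ (with $\gamma^0=1$). If it does not happen within $t$ rounds he receives $0$. The pursuer observes only his own past moves, while the evader, when moving, knows the whole history of positions $s_e^0s_p^1s_e^1\cdots s_p^\tau s_e^\tau$ (but not the pursuer's current move); both use randomized behavioral strategies and know $b$. The value $v^t\langle s_p^0\rangle(b)$ is the pursuer's expected utility in a Nash equilibrium of $G^t\langle s_p^0,b\rangle$. Then this value is well defined for every $b\in\Delta(\mathcal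 V)$ (an equilibrium exists, and all equilibria give the same expected utility), and the value function $v^t\langle s_p^0\rangle$ is piecewise linear (i.e. piecewise affine, with finitely many polyhedral pieces) and convex on the belief simplex $\Delta(\mathcal V)$. Moreover it is a maximum of finitely many affine functions: there is a finite nonempty set $A\subset\mathbb R^{\mathcal V}$ of $\alpha$-vectors such that $$v^t\langle s_p^0\rangle(b)=\max_{\alpha\in A}\sum_{v\in\mathcal V}\alpha(v)\,b(v)\qquad\text{for all } b\in\Delta(\mathcal V).$$ -/

import Mathlib

namespace PursuitEvasion

noncomputable section

/-- Joint positions of the `N` pursuing units. -/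
abbrev Positions (V : Type*) (N : ℕ) : Type _ := Fin N → V

/-- A history `s_e^0 s_p^1 s_e^1 ⋯ s_p^τ s_e^τ`: the initial vertex of the evader and the list of
the pairs `(s_p^i, s_e^i)` of the `τ` rounds played so far, the most recent round first. -/
structure History (V : Type*) (N : ℕ) where
  start : V
  rounds : List (Positions V N × V)

namespace History

variable {V : Type*} {N : ℕ}

/-- The number `τ` of rounds played so far. -/
def length (h : History V N) : ℕ := h.rounds.length

/-- The pursuer's own sequence of moves (the most recent one first), which is all that the
pursuer observes: his information sets are indexed by these sequences. -/
def pursuerSeq (h : History V N) : List (Positions V N) := h.rounds.map Prod.fst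

/-- The history after one more round, in which the pursuer moves to `sp` and the evader to `se`. -/
def extend (h : History V N) (sp : Positions V N) (se : V) : History V N :=
  ⟨h.start, (sp, se) :: h.rounds⟩

/-- The current vertex of the evader. -/
def evaderPos (h : History V N) : V := (h.rounds.map Prod.snd).headD h.start

/-- The current vertices of the pursuing units, when they started in `sp₀`. -/
def pursuerPos (sp₀ : Positions V N) (h : History V N) : Positions V N := h.pursuerSeq.headD sp₀

/-- The evader is caught: she is in the same vertex as one of the pursuing units. -/
def Caught (sp₀ : Positions V N) (h : History V N) : Prop :=
  ∃ i, h.pursuerPos sp₀ i = h.evaderPos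

end History

variable {V : Type*} [Fintype V] {N : ℕ}

/-- Behavioral strategies of the pursuer: after every sequence of his own moves, a probability
distribution on joint positions in which every unit has moved to an adjacent vertex. (Sequences
that do not occur in the game are also assigned a distribution; it has no effect.) -/
def pursuerStrategies (G : Digraph V) (sp₀ : Positions V N) :
    Set (List (Positions V N) → Positions V N → ℝ) :=
  {σ | ∀ l : List (Positions V N), σ l ∈ stdSimplex ℝ (Positions V N) ∧
    ∀ sp : Positions V N, σ l sp ≠ 0 → ∀ i, G.Adj (l.headD sp₀ i) (sp i)}

/-- Behavioral strategies of the evader: after every history (that is, knowing everything except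
the move that the pursuer makes in the current round), a probability distribution on the vertices
adjacent to her current one. (Histories that do not occur are also assigned a distribution; it has
no effect.) -/
def evaderStrategies (G : Digraph V) (N : ℕ) : Set (History V N → V → ℝ) :=
  {σ | ∀ h : History V N, σ h ∈ stdSimplex ℝ V ∧ ∀ se : V, σ h se ≠ 0 → G.Adj h.evaderPos se}

open Classical in
/-- The pursuer's expected utility from history `h` on, when `n` rounds remain: it is `γ ^ τ` once
the evader is caught after `τ` rounds, `0` if no round remains and the evader is not caught, and
otherwise both players move simultaneously according to their strategies. -/
def utilityFrom (γ : ℝ) (sp₀ : Positions V N) (σp : List (Positions V N) → Positions V N → ℝ)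
    (σe : History V N → V → ℝ) : ℕ → History V N → ℝ
  | 0, h => if h.Caught sp₀ then γ ^ h.length else 0
  | n + 1, h =>
      if h.Caught sp₀ then γ ^ h.length
      else ∑ sp : Positions V N, ∑ se : V,
        σp h.pursuerSeq sp * σe h se * utilityFrom γ sp₀ σp σe n (h.extend sp se)

/-- The pursuer's expected utility in the horizon-`t` game with initial pursuer positions `sp₀`
and initial belief `b`; the initial vertex of the evader is drawn from `b`. -/
def expectedUtility (γ : ℝ) (t : ℕ) (sp₀ : Positions V N) (b : V → ℝ)
    (σp : List (Positions V N) → Positions V N → ℝ) (σe : History V N → V → ℝ) : ℝ :=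
  ∑ se : V, b se * utilityFrom γ sp₀ σp σe t ⟨se, []⟩

/-- Nash equilibria of the zero-sum horizon-`t` game: the pursuer maximizes and the evader
minimizes the expected utility of the pursuer. -/
structure IsNashEquilibrium (G : Digraph V) (γ : ℝ) (t : ℕ) (sp₀ : Positions V N) (b : V → ℝ)
    (σp : List (Positions V N) → Positions V N → ℝ) (σe : History V N → V → ℝ) : Prop where
  pursuer_mem : σp ∈ pursuerStrategies G sp₀
  evader_mem : σe ∈ evaderStrategies G N
  pursuer_best : ∀ σp' ∈ pursuerStrategies G sp₀,
    expectedUtility γ t sp₀ b σp' σe ≤ expectedUtility γ t sp₀ b σp σe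
  evader_best : ∀ σe' ∈ evaderStrategies G N,
    expectedUtility γ t sp₀ b σp σe ≤ expectedUtility γ t sp₀ b σp σe'

/-- `v` is a value of the game: the expected utility of the pursuer in a Nash equilibrium. -/
def IsGameValue (G : Digraph V) (γ : ℝ) (t : ℕ) (sp₀ : Positions V N) (b : V → ℝ) (v : ℝ) : Prop :=
  ∃ σp σe, IsNashEquilibrium G γ t sp₀ b σp σe ∧ expectedUtility γ t sp₀ b σp σe = v

open Classical in
/-- The value function, as a function of the belief: the value of the game (with the
default `0` should the game have no equilibrium). -/
def valueFunction (G : Digraph V) (γ : ℝ) (t : ℕ) (sp₀ : Positions V N) (b : V → ℝ) : ℝ :=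
  if h : ∃ v, IsGameValue G γ t sp₀ b v then h.choose else 0

/-- A polyhedron: the solution set of finitely many affine inequalities. -/
def IsPolyhedron (P : Set (V → ℝ)) : Prop :=
  ∃ C : Set ((V → ℝ) →ᵃ[ℝ] ℝ), C.Finite ∧ P = {x | ∀ c ∈ C, 0 ≤ c x}

/-- `f` is piecewise linear (that is, piecewise affine) on `S`: finitely many polyhedra have
union `S`, and on each of them `f` agrees with an affine function. -/
def PiecewiseLinearOn (S : Set (V → ℝ)) (f : (V → ℝ) → ℝ) : Prop :=
  ∃ F : Set (Set (V → ℝ)), F.Finite ∧ (∀ P ∈ F, IsPolyhedron P) ∧ ⋃₀ F = S ∧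
    ∀ P ∈ F, ∃ g : (V → ℝ) →ᵃ[ℝ] ℝ, ∀ x ∈ P, f x = g x

end

end PursuitEvasion

/-! Fix a realization plan `x` of the pursuer, that is, the probabilities of his move sequences
under his own choices. The evader knows the whole history, including her initial vertex, so backward
induction yields her best reply separately from each initial vertex `s`. The resulting utility
f_s(x), which is `bestResponseUtility`, does not involve the belief and is a minimum of finitely
many linear functionals of `x` (`isFiniteMinOfLinear_bestResponseUtility`). The value at b is the
maximum over plans of ∑ b(s) f_s(x) (`isGreatest_valueFunction`). The plan polytope is covered by
finitely many cells, independent of b, on each of which every f_s is linear. On a cell the maximum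
is attained at an extreme point, so the extreme points e of all cells serve every belief at once
(`exists_finite_maximizers`), and the vectors s ↦ f_s(e) are the α-vectors. Convexity and piecewise
linearity follow. An equilibrium exists because the utility is bilinear in the two plans: Sion's
theorem gives a saddle point, and every plan comes from a behavioral strategy
(`exists_pursuerPlan_eq`, `exists_evaderPlan_eq`). -/

namespace PursuitEvasion

/-! ### Finite minima of linear functionals -/

/-- The pointwise minimum of a finite nonempty set of continuous linear functionals. -/
def IsFiniteMinOfLinear {E : Type*} [AddCommGroup E] [Module ℝ E] [TopologicalSpace E]
    (g : E → ℝ) : Prop :=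
  ∃ L : Set (E →L[ℝ] ℝ), L.Finite ∧ ∀ x, (∀ φ ∈ L, g x ≤ φ x) ∧ ∃ φ ∈ L, g x = φ x

namespace IsFiniteMinOfLinear

variable {E : Type*} [AddCommGroup E] [Module ℝ E] [TopologicalSpace E]

theorem of_linear (φ : E →L[ℝ] ℝ) : IsFiniteMinOfLinear (fun x => φ x) :=
  ⟨{φ}, Set.finite_singleton φ, fun x => by simp⟩

theorem add [ContinuousAdd E] {g h : E → ℝ} (hg : IsFiniteMinOfLinear g)
    (hh : IsFiniteMinOfLinear h) : IsFiniteMinOfLinear (fun x => g x + h x) := by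
  obtain ⟨L, hL, hgL⟩ := hg
  obtain ⟨M, hM, hhM⟩ := hh
  refine ⟨Set.image2 (· + ·) L M, hL.image2 _ hM, fun x => ⟨?_, ?_⟩⟩
  · rintro _ ⟨φ, hφ, ψ, hψ, rfl⟩
    exact add_le_add ((hgL x).1 φ hφ) ((hhM x).1 ψ hψ)
  · obtain ⟨φ, hφ, h1⟩ := (hgL x).2
    obtain ⟨ψ, hψ, h2⟩ := (hhM x).2
    exact ⟨φ + ψ, ⟨φ, hφ, ψ, hψ, rfl⟩, by simp [h1, h2]⟩

theorem sum [ContinuousAdd E] {ι : Type*} (s : Finset ι) {g : ι → E → ℝ}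
    (hg : ∀ i, IsFiniteMinOfLinear (g i)) : IsFiniteMinOfLinear (fun x => ∑ i ∈ s, g i x) := by
  classical
  induction s using Finset.induction_on with
  | empty => simpa using of_linear (0 : E →L[ℝ] ℝ)
  | insert a s ha ih => simpa [Finset.sum_insert ha] using (hg a).add ih

theorem iInf {ι : Type*} [Finite ι] [Nonempty ι] {g : ι → E → ℝ}
    (hg : ∀ i, IsFiniteMinOfLinear (g i)) : IsFiniteMinOfLinear (fun x => ⨅ i, g i x) := by
  choose L hL hgL using hg
  refine ⟨⋃ i, L i, Set.finite_iUnion hL, fun x => ⟨?_, ?_⟩⟩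
  · intro φ hφ
    obtain ⟨i, hi⟩ := Set.mem_iUnion.1 hφ
    exact (ciInf_le (Set.finite_range _).bddBelow i).trans ((hgL i x).1 φ hi)
  · obtain ⟨i, hi⟩ := exists_eq_ciInf_of_finite (f := fun i => g i x)
    obtain ⟨φ, hφ, h⟩ := (hgL i x).2
    exact ⟨φ, Set.mem_iUnion.2 ⟨i, hφ⟩, hi.symm.trans h⟩

end IsFiniteMinOfLinear

/-! ### Extreme points and finite sets of maximizers -/

section Polytope

open Filter Topology

variable {E : Type*} [AddCommGroup E] [Module ℝ E]

/-- An extreme point of a set cut out by finitely many homogeneous linear inequalities from an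
affine set is determined by its active constraints. -/
theorem finite_extremePoints_of_inequalities {I : Type*} [Finite I] (g : I → E →ₗ[ℝ] ℝ)
    {M : Set E} (hM : ∀ x ∈ M, ∀ y ∈ M, ∀ c : ℝ, x + c • (x - y) ∈ M) :
    ({x | x ∈ M ∧ ∀ i, 0 ≤ g i x}.extremePoints ℝ).Finite := by
  -- There are finitely many active sets, so it suffices that an extreme point is determined by its
  -- active set.
  refine Set.Finite.of_finite_image (f := fun x => {i | g i x = 0}) (Set.toFinite _) ?_
  intro x hx y hy hxy
  have hactive : ∀ i, g i x = 0 → g i y = 0 := fun i hi => by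
    have : i ∈ {i | g i y = 0} := hxy.subset hi
    exact this
  -- Constraints active at `x` vanish on `x - y`, the others have slack; hence `x ± ε • (x - y)`
  -- stays feasible for small `ε`, and extremality of `x` forces `x = y`.
  have hev : ∀ᶠ ε : ℝ in 𝓝[>] 0, ∀ i, ε * |g i (x - y)| ≤ g i x := by
    refine eventually_all.2 fun i => ?_
    rcases eq_or_lt_of_le (hx.1.2 i) with h0 | hpos
    · refine Eventually.of_forall fun ε => ?_
      simp [map_sub, ← h0, hactive i h0.symm]
    · have ht : Tendsto (fun ε : ℝ => ε * |g i (x - y)|) (𝓝[>] 0) (𝓝 0) := by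
        have h : Continuous fun ε : ℝ => ε * |g i (x - y)| := by fun_prop
        have := h.tendsto 0
        rw [zero_mul] at this
        exact this.mono_left nhdsWithin_le_nhds
      exact (ht.eventually_lt_const hpos).mono fun _ h => h.le
  obtain ⟨ε, hε, hεpos⟩ := (hev.and self_mem_nhdsWithin).exists
  have hεpos : 0 < ε := hεpos
  have mem : ∀ c : ℝ, |c| = ε → x + c • (x - y) ∈ {x | x ∈ M ∧ ∀ i, 0 ≤ g i x} := by
    intro c hc
    refine ⟨hM x hx.1.1 y hy.1.1 c, fun i => ?_⟩
    have h1 := hε i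
    rw [← hc, ← abs_mul] at h1
    have h2 := neg_abs_le (c * g i (x - y))
    rw [map_add, map_smul, smul_eq_mul]
    linarith
  have hseg : x ∈ openSegment ℝ (x + ε • (x - y)) (x + (-ε) • (x - y)) :=
    ⟨1 / 2, 1 / 2, by norm_num, by norm_num, by norm_num, by module⟩
  have h := (mem_extremePoints_iff_left.1 hx).2 _ (mem ε (abs_of_pos hεpos)) _
    (mem (-ε) (by rw [abs_neg, abs_of_pos hεpos])) hseg
  have h' : ε • (x - y) = 0 := by simpa using h
  exact sub_eq_zero.1 ((smul_eq_zero.1 h').resolve_left hεpos.ne')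

variable [TopologicalSpace E] [T2Space E] [IsTopologicalAddGroup E] [ContinuousSMul ℝ E]
  [LocallyConvexSpace ℝ E]

/-- A continuous linear functional attains its maximum over a compact set at an extreme point. -/
theorem exists_extremePoint_le {S : Set E} (hS : IsCompact S) (φ : E →L[ℝ] ℝ) {x : E}
    (hx : x ∈ S) : ∃ e ∈ S.extremePoints ℝ, φ x ≤ φ e := by
  obtain ⟨z, hz, hmax⟩ := hS.exists_isMaxOn ⟨x, hx⟩ φ.continuous.continuousOn
  -- The maximizers form a compact exposed face; its extreme points, which exist by Krein–Milman,
  -- are extreme in `S`.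
  have hexp : IsExposed ℝ S (φ.toExposed S) := ContinuousLinearMap.toExposed.isExposed
  obtain ⟨e, he⟩ := (hexp.isCompact hS).extremePoints_nonempty ⟨z, hz, hmax⟩
  exact ⟨e, hexp.isExtreme.extremePoints_subset_extremePoints he, he.1.2 x hx⟩

/-- On a polytope, finitely many points suffice to maximize all weighted sums of given minima of
linear functionals. -/
theorem exists_finite_maximizers {I J : Type*} [Finite I] [Fintype J] (g : I → E →L[ℝ] ℝ)
    {M : Set E} (hM : ∀ x ∈ M, ∀ y ∈ M, ∀ c : ℝ, x + c • (x - y) ∈ M)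
    (hX : IsCompact {x | x ∈ M ∧ ∀ i, 0 ≤ g i x}) {f : J → E → ℝ}
    (hf : ∀ j, IsFiniteMinOfLinear (f j)) :
    ∃ A : Set E, A.Finite ∧ A ⊆ {x | x ∈ M ∧ ∀ i, 0 ≤ g i x} ∧
      ∀ x, x ∈ M → (∀ i, 0 ≤ g i x) → ∀ b : J → ℝ, ∃ a ∈ A,
        ∑ j, b j * f j x ≤ ∑ j, b j * f j a := by
  choose L hL hfL using hf
  have : ∀ j, Finite (L j) := fun j => (hL j).to_subtype
  let ineq (φ : J → E →L[ℝ] ℝ) : I ⊕ (Σ j, L j) → E →L[ℝ] ℝ :=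
    Sum.elim g fun p => p.2.1 - φ p.1
  -- The region where, for every `j`, the chosen `φ j` is minimal in `L j`; there `f j` equals `φ
  -- j`, so weights `b` of any sign give a linear objective.
  let cell (φ : J → E →L[ℝ] ℝ) : Set E := {x | x ∈ M ∧ ∀ i, 0 ≤ ineq φ i x}
  have hcell : ∀ φ x, x ∈ cell φ ↔
      (x ∈ M ∧ ∀ i, 0 ≤ g i x) ∧ ∀ j, ∀ ψ ∈ L j, φ j x ≤ ψ x := by
    intro φ x
    simp only [cell, ineq, Set.mem_ofPred_eq, Sum.forall, Sigma.forall, Subtype.forall,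
      Sum.elim_inl, Sum.elim_inr, sub_apply, sub_nonneg, and_assoc]
  have hf_cell : ∀ φ ∈ Set.univ.pi L, ∀ x ∈ cell φ, ∀ j, f j x = φ j x := by
    intro φ hφ x hx j
    obtain ⟨ψ, hψ, h⟩ := (hfL j x).2
    exact le_antisymm ((hfL j x).1 _ (hφ j trivial)) (h ▸ ((hcell φ x).1 hx).2 j ψ hψ)
  refine ⟨⋃ φ ∈ Set.univ.pi L, (cell φ).extremePoints ℝ, ?_, ?_, ?_⟩
  · refine (Set.Finite.pi hL).biUnion fun φ _ => ?_
    exact finite_extremePoints_of_inequalities (fun i => (ineq φ i : E →ₗ[ℝ] ℝ)) hM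
  · refine Set.iUnion₂_subset fun φ _ e he => ((hcell φ e).1 he.1).1
  · intro x hxM hxg b
    choose φ hφ hφx using fun j => (hfL j x).2
    have hφL : φ ∈ Set.univ.pi L := fun j _ => hφ j
    have hx : x ∈ cell φ :=
      (hcell φ x).2 ⟨⟨hxM, hxg⟩, fun j ψ hψ => hφx j ▸ (hfL j x).1 ψ hψ⟩
    have hclosed : IsClosed {x : E | ∀ j, ∀ ψ ∈ L j, φ j x ≤ ψ x} := by
      simp only [Set.ofPred_forall]
      exact isClosed_iInter fun j => isClosed_iInter fun ψ => isClosed_iInter fun _ =>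
        isClosed_le (φ j).continuous ψ.continuous
    have hcompact : IsCompact (cell φ) := by
      have : cell φ = {x | x ∈ M ∧ ∀ i, 0 ≤ g i x} ∩ {x | ∀ j, ∀ ψ ∈ L j, φ j x ≤ ψ x} :=
        Set.ext (hcell φ)
      rw [this]
      exact hX.inter_right hclosed
    obtain ⟨e, he, hle⟩ := exists_extremePoint_le hcompact (∑ j, b j • φ j) hx
    refine ⟨e, Set.mem_iUnion₂.2 ⟨φ, hφL, he⟩, ?_⟩
    simpa [sum_apply, hf_cell φ hφL x hx, hf_cell φ hφL e he.1] using hle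

end Polytope

/-! ### Convexity and polyhedral pieces of a maximum of linear functions -/

section MaxOfLinear

variable {V : Type*} [Fintype V]

theorem convexOn_of_eq_sup' {A : Finset (V → ℝ)} (hA : A.Nonempty) {f : (V → ℝ) → ℝ}
    (hf : ∀ b ∈ stdSimplex ℝ V, f b = A.sup' hA (fun α => ∑ v, α v * b v)) :
    ConvexOn ℝ (stdSimplex ℝ V) f := by
  refine ⟨convex_stdSimplex ℝ V, fun b hb c hc p q hp hq hpq => ?_⟩
  rw [hf _ (convex_stdSimplex ℝ V hb hc hp hq hpq), hf b hb, hf c hc]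
  refine Finset.sup'_le _ _ fun α hα => ?_
  have h1 := Finset.le_sup' (fun α : V → ℝ => ∑ v, α v * b v) hα
  have h2 := Finset.le_sup' (fun α : V → ℝ => ∑ v, α v * c v) hα
  have h3 : ∑ v, α v * (p • b + q • c) v = p * ∑ v, α v * b v + q * ∑ v, α v * c v := by
    rw [Finset.mul_sum, Finset.mul_sum, ← Finset.sum_add_distrib]
    exact Finset.sum_congr rfl fun v _ => by simp; ring
  rw [h3]
  exact add_le_add (mul_le_mul_of_nonneg_left h1 hp) (mul_le_mul_of_nonneg_left h2 hq)

/-- The linear functional with coefficient vector `α`, as an affine map. -/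
noncomputable def dotAffine (α : V → ℝ) : (V → ℝ) →ᵃ[ℝ] ℝ :=
  (∑ v, α v • LinearMap.proj (R := ℝ) (φ := fun _ : V => ℝ) v).toAffineMap

@[simp] theorem dotAffine_apply (α b : V → ℝ) : dotAffine α b = ∑ v, α v * b v := by
  simp [dotAffine]

theorem piecewiseLinearOn_of_eq_sup' {A : Finset (V → ℝ)} (hA : A.Nonempty) {f : (V → ℝ) → ℝ}
    (hf : ∀ b ∈ stdSimplex ℝ V, f b = A.sup' hA (fun α => ∑ v, α v * b v)) :
    PiecewiseLinearOn (stdSimplex ℝ V) f := by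
  classical
  let piece (α : V → ℝ) : Set (V → ℝ) :=
    {b | b ∈ stdSimplex ℝ V ∧ ∀ β ∈ A, ∑ v, β v * b v ≤ ∑ v, α v * b v}
  refine ⟨piece '' A, A.finite_toSet.image _, ?_, ?_, ?_⟩
  · rintro _ ⟨α, -, rfl⟩
    -- Coordinates are nonnegative, `α` beats every `β`, and the coordinate sum is 1, written as two
    -- inequalities.
    refine ⟨Set.range (fun v => dotAffine (Pi.single v 1)) ∪
      ((fun β => dotAffine α - dotAffine β) '' A ∪
      {dotAffine 1 - AffineMap.const ℝ _ 1, AffineMap.const ℝ _ 1 - dotAffine 1}), ?_, ?_⟩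
    · exact (Set.finite_range _).union ((A.finite_toSet.image _).union (by simp))
    · ext b
      simp only [piece, stdSimplex, Set.mem_ofPred_eq, Set.mem_union, or_imp, forall_and,
        Set.forall_mem_range, Set.forall_mem_image, Set.mem_insert_iff, Set.mem_singleton_iff,
        forall_eq, AffineMap.coe_sub, Pi.sub_apply, dotAffine_apply, AffineMap.const_apply,
        sub_nonneg, Pi.one_apply, one_mul, Pi.single_apply, ite_mul, zero_mul,
        Finset.sum_ite_eq', Finset.mem_univ, if_true, Finset.mem_coe]
      constructor
      · rintro ⟨⟨h1, h2⟩, h3⟩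
        exact ⟨h1, h3, h2.ge, h2.le⟩
      · rintro ⟨h1, h3, h2, h2'⟩
        exact ⟨⟨h1, le_antisymm h2' h2⟩, h3⟩
  · refine Set.Subset.antisymm (Set.sUnion_subset ?_) fun b hb => ?_
    · rintro _ ⟨α, -, rfl⟩ b hb
      exact hb.1
    · obtain ⟨α, hα, hmax⟩ := A.exists_max_image (fun α => ∑ v, α v * b v) hA
      exact ⟨piece α, ⟨α, hα, rfl⟩, hb, hmax⟩
  · rintro _ ⟨α, hα, rfl⟩
    refine ⟨dotAffine α, fun b hb => ?_⟩
    rw [hf b hb.1, dotAffine_apply]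
    exact le_antisymm (Finset.sup'_le _ _ hb.2)
      (Finset.le_sup' (fun α : V → ℝ => ∑ v, α v * b v) hα)

end MaxOfLinear

end PursuitEvasion
namespace PursuitEvasion

/-! ### Compact convex sets of realization plans -/

section Plans

variable {V : Type*} [Fintype V] {N : ℕ}

/-- The affine conditions on the realization plans of the pursuer: the reach probabilities, under
his own choices, of the sequences of at most `t` moves. Longer sequences get the value `0`. -/
structure IsPursuerFlow (G : Digraph V) (sp₀ : Positions V N) (t : ℕ)
    (x : List (Positions V N) → ℝ) : Prop where
  nil : x [] = 1
  sum_cons : ∀ l, l.length < t → ∑ sp, x (sp :: l) = x l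
  eq_zero_of_lt : ∀ l, t < l.length → x l = 0
  eq_zero_of_not_adj : ∀ l sp, (¬ ∀ i, G.Adj (l.headD sp₀ i) (sp i)) → x (sp :: l) = 0

/-- Realization plans of the pursuer. -/
def pursuerPlans (G : Digraph V) (sp₀ : Positions V N) (t : ℕ) :
    Set (List (Positions V N) → ℝ) :=
  {x | IsPursuerFlow G sp₀ t x ∧ ∀ l : {l : List (Positions V N) // l.length ≤ t}, 0 ≤ x l}

/-- Realization plans of the evader: the reach probabilities, under her own choices, of the
histories. They do not depend on the pursuer's last move, which she does not know. -/
structure IsEvaderPlan (G : Digraph V) (N : ℕ) (y : History V N → ℝ) : Prop where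
  nonneg : ∀ h, 0 ≤ y h
  start : ∀ s, y ⟨s, []⟩ = 1
  sum_extend : ∀ h sp, ∑ se, y (h.extend sp se) = y h
  extend_congr : ∀ (h : History V N) sp sp' se, y (h.extend sp se) = y (h.extend sp' se)
  eq_zero_of_not_adj : ∀ (h : History V N) sp se, ¬ G.Adj h.evaderPos se → y (h.extend sp se) = 0

/-- The set of realization plans of the evader. -/
def evaderPlans (G : Digraph V) (N : ℕ) : Set (History V N → ℝ) := {y | IsEvaderPlan G N y}

variable {G : Digraph V} {sp₀ : Positions V N} {t : ℕ}

/-- The flow conditions are affine equations, so they persist along whole lines; this is the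
hypothesis on `M` in `exists_finite_maximizers`. -/
theorem IsPursuerFlow.add_smul_sub {x y : List (Positions V N) → ℝ} (hx : IsPursuerFlow G sp₀ t x)
    (hy : IsPursuerFlow G sp₀ t y) (c : ℝ) : IsPursuerFlow G sp₀ t (x + c • (x - y)) where
  nil := by simp [hx.nil, hy.nil]
  sum_cons l hl := by
    simp [Finset.sum_add_distrib, ← Finset.mul_sum, hx.sum_cons l hl, hy.sum_cons l hl]
  eq_zero_of_lt l hl := by simp [hx.eq_zero_of_lt l hl, hy.eq_zero_of_lt l hl]
  eq_zero_of_not_adj l sp h := by simp [hx.eq_zero_of_not_adj l sp h, hy.eq_zero_of_not_adj l sp h]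

theorem nonneg_of_mem_pursuerPlans {x : List (Positions V N) → ℝ} (hx : x ∈ pursuerPlans G sp₀ t)
    (l : List (Positions V N)) : 0 ≤ x l := by
  rcases le_or_gt l.length t with h | h
  · exact hx.2 ⟨l, h⟩
  · exact (hx.1.eq_zero_of_lt l h).ge

theorem le_one_of_mem_pursuerPlans {x : List (Positions V N) → ℝ} (hx : x ∈ pursuerPlans G sp₀ t)
    (l : List (Positions V N)) : x l ≤ 1 := by
  induction l with
  | nil => exact hx.1.nil.le
  | cons sp l ih =>
    rcases lt_or_ge l.length t with h | h
    · refine le_trans ?_ ih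
      rw [← hx.1.sum_cons l h]
      exact Finset.single_le_sum (f := fun sp => x (sp :: l))
        (fun sp _ => nonneg_of_mem_pursuerPlans hx _) (Finset.mem_univ sp)
    · rw [hx.1.eq_zero_of_lt _ (by simpa using Nat.lt_succ_of_le h)]
      exact zero_le_one

theorem convex_pursuerPlans : Convex ℝ (pursuerPlans G sp₀ t) := by
  intro x hx y hy p q hp hq hpq
  refine ⟨?_, fun l => ?_⟩
  · have h := hx.1.add_smul_sub hy.1 (-q)
    have h' : x + (-q) • (x - y) = p • x + q • y := by
      rw [← eq_sub_iff_add_eq] at hpq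
      rw [hpq]; module
    rwa [h'] at h
  · have h1 := hx.2 l
    have h2 := hy.2 l
    simp only [Pi.add_apply, Pi.smul_apply, smul_eq_mul]
    positivity

theorem isClosed_pursuerPlans : IsClosed (pursuerPlans G sp₀ t) := by
  have : pursuerPlans G sp₀ t = {x | x [] = 1} ∩
      {x | ∀ l, l.length < t → ∑ sp, x (sp :: l) = x l} ∩ {x | ∀ l, t < l.length → x l = 0} ∩
      {x | ∀ l sp, (¬ ∀ i, G.Adj (l.headD sp₀ i) (sp i)) → x (sp :: l) = 0} ∩
      {x | ∀ l : {l : List (Positions V N) // l.length ≤ t}, 0 ≤ x l} := by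
    ext x
    exact ⟨fun h => ⟨⟨⟨⟨h.1.1, h.1.2⟩, h.1.3⟩, h.1.4⟩, h.2⟩,
      fun h => ⟨⟨h.1.1.1.1, h.1.1.1.2, h.1.1.2, h.1.2⟩, h.2⟩⟩
  rw [this]
  simp only [Set.ofPred_forall]
  refine ((((isClosed_eq ?_ ?_).inter ?_).inter ?_).inter ?_).inter ?_
  any_goals fun_prop
  · exact isClosed_iInter fun l => isClosed_iInter fun _ => isClosed_eq (by fun_prop) (by fun_prop)
  · exact isClosed_iInter fun l => isClosed_iInter fun _ => isClosed_eq (by fun_prop) (by fun_prop)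
  · exact isClosed_iInter fun l => isClosed_iInter fun _ => isClosed_iInter fun _ =>
      isClosed_eq (by fun_prop) (by fun_prop)
  · exact isClosed_iInter fun l => isClosed_le (by fun_prop) (by fun_prop)

/-- Tychonoff: a closed subset of a product of unit intervals. -/
theorem isCompact_pursuerPlans : IsCompact (pursuerPlans G sp₀ t) :=
  (isCompact_univ_pi fun _ => isCompact_Icc (a := (0 : ℝ)) (b := 1)).of_isClosed_subset
    isClosed_pursuerPlans fun _ hx l _ =>
      ⟨nonneg_of_mem_pursuerPlans hx l, le_one_of_mem_pursuerPlans hx l⟩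

theorem IsEvaderPlan.le_one {y : History V N → ℝ} (hy : IsEvaderPlan G N y) (h : History V N) :
    y h ≤ 1 := by
  obtain ⟨s, l⟩ := h
  induction l with
  | nil => exact (hy.start s).le
  | cons r l ih =>
    refine le_trans ?_ ih
    rw [← hy.sum_extend ⟨s, l⟩ r.1]
    exact Finset.single_le_sum (f := fun se => y (History.extend ⟨s, l⟩ r.1 se))
      (fun _ _ => hy.nonneg _) (Finset.mem_univ r.2)

theorem convex_evaderPlans : Convex ℝ (evaderPlans G N) := by
  intro x hx y hy p q hp hq hpq
  have hx : IsEvaderPlan G N x := hx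
  have hy : IsEvaderPlan G N y := hy
  refine IsEvaderPlan.mk (fun h => ?_) (fun s => ?_) (fun h sp => ?_) (fun h sp sp' se => ?_)
    (fun h sp se hadj => ?_)
  · have h1 := hx.nonneg h
    have h2 := hy.nonneg h
    simp only [Pi.add_apply, Pi.smul_apply, smul_eq_mul]
    positivity
  · simp [hx.start, hy.start, hpq]
  · simp [Finset.sum_add_distrib, ← Finset.mul_sum, hx.sum_extend, hy.sum_extend]
  · simp [hx.extend_congr h sp sp' se, hy.extend_congr h sp sp' se]
  · simp [hx.eq_zero_of_not_adj h sp se hadj, hy.eq_zero_of_not_adj h sp se hadj]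

theorem isClosed_evaderPlans : IsClosed (evaderPlans G N) := by
  have : evaderPlans G N = {y | ∀ h, 0 ≤ y h} ∩ {y | ∀ s, y ⟨s, []⟩ = 1} ∩
      {y | ∀ h sp, ∑ se, y (h.extend sp se) = y h} ∩
      {y | ∀ (h : History V N) sp sp' se, y (h.extend sp se) = y (h.extend sp' se)} ∩
      {y | ∀ (h : History V N) sp se, ¬ G.Adj h.evaderPos se → y (h.extend sp se) = 0} := by
    ext y
    exact ⟨fun h => ⟨⟨⟨⟨h.1, h.2⟩, h.3⟩, h.4⟩, h.5⟩,
      fun h => ⟨h.1.1.1.1, h.1.1.1.2, h.1.1.2, h.1.2, h.2⟩⟩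
  rw [this]
  simp only [Set.ofPred_forall]
  refine ((((?_ : IsClosed _).inter ?_).inter ?_).inter ?_).inter ?_
  · exact isClosed_iInter fun h => isClosed_le (by fun_prop) (by fun_prop)
  · exact isClosed_iInter fun l => isClosed_eq (by fun_prop) (by fun_prop)
  · exact isClosed_iInter fun l => isClosed_iInter fun _ => isClosed_eq (by fun_prop) (by fun_prop)
  · exact isClosed_iInter fun l => isClosed_iInter fun _ => isClosed_iInter fun _ =>
      isClosed_iInter fun _ => isClosed_eq (by fun_prop) (by fun_prop)
  · exact isClosed_iInter fun l => isClosed_iInter fun _ => isClosed_iInter fun _ =>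
      isClosed_iInter fun _ => isClosed_eq (by fun_prop) (by fun_prop)

/-- Evader plans are not cut off at the horizon and have infinitely many coordinates; this is
harmless, since only compactness and convexity are used for them. -/
theorem isCompact_evaderPlans : IsCompact (evaderPlans G N) :=
  (isCompact_univ_pi fun _ => isCompact_Icc (a := (0 : ℝ)) (b := 1)).of_isClosed_subset
    isClosed_evaderPlans fun _ hy h _ => ⟨IsEvaderPlan.nonneg hy h, IsEvaderPlan.le_one hy h⟩

end Plans

/-! ### Realization plans versus behavioral strategies -/

section Kuhn

variable {V : Type*} {N : ℕ}

/-- The realization plan of a behavioral strategy of the pursuer. -/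
def pursuerPlan (t : ℕ) (σ : List (Positions V N) → Positions V N → ℝ) :
    List (Positions V N) → ℝ
  | [] => 1
  -- The cutoff leaves only finitely many nonnegativity constraints, as the finiteness of extreme
  -- points requires.
  | sp :: l => if l.length < t then pursuerPlan t σ l * σ l sp else 0

/-- The realization plan of a behavioral strategy of the evader, for a given initial vertex. -/
def evaderPlanFrom (σ : History V N → V → ℝ) (s : V) : List (Positions V N × V) → ℝ
  | [] => 1
  | r :: l => evaderPlanFrom σ s l * σ ⟨s, l⟩ r.2

/-- The realization plan of a behavioral strategy of the evader. -/
def evaderPlan (σ : History V N → V → ℝ) (h : History V N) : ℝ :=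
  evaderPlanFrom σ h.start h.rounds

theorem pursuerPlan_cons {t : ℕ} (σ : List (Positions V N) → Positions V N → ℝ)
    (l : List (Positions V N)) (hl : l.length < t) (sp : Positions V N) :
    pursuerPlan t σ (sp :: l) = pursuerPlan t σ l * σ l sp := by
  simp [pursuerPlan, hl]

theorem evaderPlan_extend (σ : History V N → V → ℝ) (h : History V N) (sp : Positions V N)
    (se : V) : evaderPlan σ (h.extend sp se) = evaderPlan σ h * σ h se := rfl

theorem evaderPlan_start (σ : History V N → V → ℝ) (s : V) : evaderPlan σ ⟨s, []⟩ = 1 := rfl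

variable [Fintype V] {G : Digraph V} {sp₀ : Positions V N} {t : ℕ}

theorem pursuerPlan_mem {σ : List (Positions V N) → Positions V N → ℝ}
    (hσ : σ ∈ pursuerStrategies G sp₀) : pursuerPlan t σ ∈ pursuerPlans G sp₀ t := by
  refine ⟨⟨rfl, fun l hl => ?_, fun l hl => ?_, fun l sp h => ?_⟩, fun ⟨l, hl⟩ => ?_⟩
  · simp_rw [pursuerPlan_cons σ l hl]
    rw [← Finset.mul_sum, (hσ l).1.2, mul_one]
  · cases l with
    | nil => simp at hl
    | cons sp l => simp [pursuerPlan, Nat.not_lt.2 (Nat.le_of_lt_succ hl)]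
  · have : σ l sp = 0 := by_contra fun h' => h ((hσ l).2 sp h')
    simp [pursuerPlan, this]
  · induction l with
    | nil => simp [pursuerPlan]
    | cons sp l ih =>
      rw [pursuerPlan_cons σ l hl]
      exact mul_nonneg (ih (Nat.le_of_succ_le hl)) ((hσ l).1.1 sp)

theorem isEvaderPlan_evaderPlan {σ : History V N → V → ℝ} (hσ : σ ∈ evaderStrategies G N) :
    IsEvaderPlan G N (evaderPlan σ) where
  nonneg := by
    rintro ⟨s, l⟩
    induction l with
    | nil => exact zero_le_one
    | cons r l ih => exact mul_nonneg ih ((hσ ⟨s, l⟩).1.1 r.2)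
  start _ := rfl
  sum_extend h sp := by
    simp_rw [evaderPlan_extend]
    rw [← Finset.mul_sum, (hσ h).1.2, mul_one]
  extend_congr _ _ _ _ := rfl
  eq_zero_of_not_adj h sp se hadj := by
    have : σ h se = 0 := by_contra fun h' => hadj ((hσ h).2 se h')
    simp [evaderPlan_extend, this]

theorem pursuerStrategies_nonempty (hG : ∀ v, ∃ w, G.Adj v w) :
    (pursuerStrategies G sp₀).Nonempty := by
  classical
  choose w hw using hG
  refine ⟨fun l => Pi.single (fun i => w (l.headD sp₀ i)) 1, fun l =>
    ⟨single_mem_stdSimplex ℝ _, fun sp hsp i => ?_⟩⟩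
  rw [show sp = fun i => w (l.headD sp₀ i) from
    by_contra fun h => hsp (Pi.single_eq_of_ne h _)]
  exact hw _

/-- The deterministic strategy of the evader given by a choice of moves. -/
theorem single_mem_evaderStrategies [DecidableEq V] {c : History V N → V}
    (hc : ∀ h : History V N, G.Adj h.evaderPos (c h)) :
    (fun h => Pi.single (c h) (1 : ℝ)) ∈ evaderStrategies G N := by
  refine fun h => ⟨single_mem_stdSimplex ℝ _, fun se hse => ?_⟩
  rw [show se = c h from by_contra fun h => hse (Pi.single_eq_of_ne h _)]
  exact hc h

theorem evaderStrategies_nonempty (hG : ∀ v, ∃ w, G.Adj v w) :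
    (evaderStrategies G N).Nonempty := by
  classical
  choose w hw using hG
  exact ⟨_, single_mem_evaderStrategies fun h => hw h.evaderPos⟩

/-- Every realization plan of the pursuer comes from a behavioral strategy. -/
theorem exists_pursuerPlan_eq (hG : ∀ v, ∃ w, G.Adj v w) {x : List (Positions V N) → ℝ}
    (hx : x ∈ pursuerPlans G sp₀ t) : ∃ σ ∈ pursuerStrategies G sp₀, pursuerPlan t σ = x := by
  classical
  obtain ⟨τ, hτ⟩ := pursuerStrategies_nonempty (sp₀ := sp₀) hG
  have hnonneg := nonneg_of_mem_pursuerPlans hx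
  -- Conditional probabilities where the plan reaches `l` before the horizon, an arbitrary strategy
  -- `τ` elsewhere.
  refine ⟨fun l sp => if l.length < t ∧ x l ≠ 0 then x (sp :: l) / x l else τ l sp,
    fun l => ?_, ?_⟩
  · by_cases h : l.length < t ∧ x l ≠ 0
    · simp only [h, if_true, ne_eq, not_false_eq_true, and_self]
      refine ⟨⟨fun sp => div_nonneg (hnonneg _) (hnonneg _), ?_⟩, fun sp hsp => ?_⟩
      · rw [← Finset.sum_div, hx.1.sum_cons l h.1, div_self h.2]
      · by_contra hadj
        exact hsp (by rw [hx.1.eq_zero_of_not_adj l sp hadj, zero_div])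
    · simp only [h, if_false]
      exact hτ l
  · funext l
    induction l with
    | nil => exact hx.1.nil.symm
    | cons sp l ih =>
      by_cases hl : l.length < t
      · rw [pursuerPlan_cons _ l hl, ih]
        by_cases h0 : x l = 0
        -- Below an unreached sequence the plan vanishes too, being nonnegative with sum zero, so
        -- the choice of `τ` does not matter.
        · have hsum := hx.1.sum_cons l hl
          rw [h0, Finset.sum_eq_zero_iff_of_nonneg fun sp _ => hnonneg _] at hsum
          rw [h0, zero_mul, hsum sp (Finset.mem_univ sp)]
        · simp only [hl, h0, ne_eq, not_false_eq_true, and_self, if_true]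
          field_simp
      · rw [hx.1.eq_zero_of_lt (sp :: l) (Nat.lt_succ_of_le (Nat.le_of_not_lt hl))]
        simp [pursuerPlan, hl]

/-- Every realization plan of the evader comes from a behavioral strategy. -/
theorem exists_evaderPlan_eq (hG : ∀ v, ∃ w, G.Adj v w) (sp₀ : Positions V N)
    {y : History V N → ℝ} (hy : IsEvaderPlan G N y) :
    ∃ σ ∈ evaderStrategies G N, evaderPlan σ = y := by
  classical
  obtain ⟨τ, hτ⟩ := evaderStrategies_nonempty (N := N) hG
  refine ⟨fun h se => if y h ≠ 0 then y (h.extend sp₀ se) / y h else τ h se, fun h => ?_, ?_⟩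
  · by_cases h0 : y h ≠ 0
    · simp only [h0, if_true, ne_eq, not_false_eq_true]
      refine ⟨⟨fun se => div_nonneg (hy.nonneg _) (hy.nonneg _), ?_⟩, fun se hse => ?_⟩
      · rw [← Finset.sum_div, hy.sum_extend, div_self h0]
      · by_contra hadj
        exact hse (by rw [hy.eq_zero_of_not_adj h sp₀ se hadj, zero_div])
    · simp only [h0, if_false]
      exact hτ h
  · funext ⟨s, l⟩
    induction l with
    | nil => exact (hy.start s).symm
    | cons r l ih =>
      rw [show (⟨s, r :: l⟩ : History V N) = History.extend ⟨s, l⟩ r.1 r.2 from rfl,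
        evaderPlan_extend, ih, hy.extend_congr _ r.1 sp₀]
      by_cases h0 : y ⟨s, l⟩ = 0
      · have hsum := hy.sum_extend ⟨s, l⟩ sp₀
        rw [h0, Finset.sum_eq_zero_iff_of_nonneg fun se _ => hy.nonneg _] at hsum
        rw [h0, zero_mul, hsum r.2 (Finset.mem_univ r.2)]
      · simp only [h0, ne_eq, not_false_eq_true, if_true]
        field_simp

end Kuhn

end PursuitEvasion
namespace PursuitEvasion

/-! ### Utility in terms of plans, and the evader's best reply -/

section Utility

variable {V : Type*} [Fintype V] {N : ℕ}

open Classical in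
/-- The pursuer's utility from history `h` on, weighted with the reach probability of `h`, in
terms of realization plans. -/
noncomputable def planUtility (γ : ℝ) (sp₀ : Positions V N) (x : List (Positions V N) → ℝ)
    (y : History V N → ℝ) : ℕ → History V N → ℝ
  | 0, h => if h.Caught sp₀ then γ ^ h.length * (x h.pursuerSeq * y h) else 0
  | n + 1, h =>
      if h.Caught sp₀ then γ ^ h.length * (x h.pursuerSeq * y h)
      else ∑ sp : Positions V N, ∑ se : V, planUtility γ sp₀ x y n (h.extend sp se)

open Classical in
/-- The utility from history `h` on, weighted with the pursuer's reach probability of `h`, when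
the evader plays optimally against the realization plan `x` from `h` on. -/
noncomputable def bestResponseUtility (G : Digraph V) (γ : ℝ) (sp₀ : Positions V N)
    (x : List (Positions V N) → ℝ) : ℕ → History V N → ℝ
  | 0, h => if h.Caught sp₀ then γ ^ h.length * x h.pursuerSeq else 0
  | n + 1, h =>
      if h.Caught sp₀ then γ ^ h.length * x h.pursuerSeq
      else ⨅ se : {v // G.Adj h.evaderPos v},
        ∑ sp : Positions V N, bestResponseUtility G γ sp₀ x n (h.extend sp se)

variable {G : Digraph V} {γ : ℝ} {sp₀ : Positions V N} {t : ℕ}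

/-- Each round multiplies the two reach probabilities by the move probabilities; `hn` keeps the
sequences within the horizon, where the cutoff has no effect. -/
theorem planUtility_pursuerPlan_evaderPlan (σp : List (Positions V N) → Positions V N → ℝ)
    (σe : History V N → V → ℝ) (n : ℕ) (h : History V N) (hn : h.length + n ≤ t) :
    planUtility γ sp₀ (pursuerPlan t σp) (evaderPlan σe) n h =
      pursuerPlan t σp h.pursuerSeq * evaderPlan σe h * utilityFrom γ sp₀ σp σe n h := by
  induction n generalizing h with
  | zero =>
    simp only [planUtility, utilityFrom]
    split_ifs <;> ring
  | succ n ih =>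
    simp only [planUtility, utilityFrom]
    split_ifs with hc
    · ring
    · rw [Finset.mul_sum]
      refine Finset.sum_congr rfl fun sp _ => ?_
      rw [Finset.mul_sum]
      refine Finset.sum_congr rfl fun se _ => ?_
      have hlen : (h.extend sp se).length = h.length + 1 := rfl
      have hseq : h.pursuerSeq.length < t := by
        have : h.pursuerSeq.length = h.length := List.length_map _
        omega
      rw [ih (h.extend sp se) (by omega), evaderPlan_extend,
        show (h.extend sp se).pursuerSeq = sp :: h.pursuerSeq from rfl, pursuerPlan_cons σp _ hseq]
      ring

theorem expectedUtility_eq_planUtility (b : V → ℝ)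
    (σp : List (Positions V N) → Positions V N → ℝ) (σe : History V N → V → ℝ) :
    expectedUtility γ t sp₀ b σp σe =
      ∑ s, b s * planUtility γ sp₀ (pursuerPlan t σp) (evaderPlan σe) t ⟨s, []⟩ := by
  refine Finset.sum_congr rfl fun s _ => ?_
  rw [planUtility_pursuerPlan_evaderPlan σp σe t ⟨s, []⟩ (Nat.zero_add t).le, evaderPlan_start,
    show pursuerPlan t σp (History.pursuerSeq ⟨s, []⟩) = 1 from rfl, one_mul, one_mul]

/-- Every terminal history contributes a constant times one value of `x` and one of `y`. Linearity
in each plan separately is what the minimax theorem needs. -/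
theorem exists_linear_planUtility_left (y : History V N → ℝ) (n : ℕ) (h : History V N) :
    ∃ φ : (List (Positions V N) → ℝ) →L[ℝ] ℝ, ∀ x, planUtility γ sp₀ x y n h = φ x := by
  induction n generalizing h with
  | zero =>
    by_cases hc : h.Caught sp₀
    · exact ⟨(γ ^ h.length * y h) • .proj h.pursuerSeq, fun x => by
        simp [planUtility, hc]; ring⟩
    · exact ⟨0, fun x => by simp [planUtility, hc]⟩
  | succ n ih =>
    by_cases hc : h.Caught sp₀
    · exact ⟨(γ ^ h.length * y h) • .proj h.pursuerSeq, fun x => by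
        simp [planUtility, hc]; ring⟩
    · choose φ hφ using ih
      exact ⟨∑ sp, ∑ se, φ (h.extend sp se), fun x => by
        simp [planUtility, hc, hφ, sum_apply]⟩

theorem exists_linear_planUtility_right (x : List (Positions V N) → ℝ) (n : ℕ)
    (h : History V N) :
    ∃ φ : (History V N → ℝ) →L[ℝ] ℝ, ∀ y, planUtility γ sp₀ x y n h = φ y := by
  induction n generalizing h with
  | zero =>
    by_cases hc : h.Caught sp₀
    · exact ⟨(γ ^ h.length * x h.pursuerSeq) • .proj h, fun y => by
        simp [planUtility, hc]; ring⟩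
    · exact ⟨0, fun y => by simp [planUtility, hc]⟩
  | succ n ih =>
    by_cases hc : h.Caught sp₀
    · exact ⟨(γ ^ h.length * x h.pursuerSeq) • .proj h, fun y => by
        simp [planUtility, hc]; ring⟩
    · choose φ hφ using ih
      exact ⟨∑ sp, ∑ se, φ (h.extend sp se), fun y => by
        simp [planUtility, hc, hφ, sum_apply]⟩

/-- Backward induction alternates finite sums over the pursuer's moves with finite nonempty minima
over the evader's, and both preserve this class. The minimum stands outside the sum because she does
not see his current move. -/
theorem isFiniteMinOfLinear_bestResponseUtility (hG : ∀ v, ∃ w, G.Adj v w) (n : ℕ)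
    (h : History V N) :
    IsFiniteMinOfLinear fun x => bestResponseUtility G γ sp₀ x n h := by
  have hcaught : ∀ h : History V N, IsFiniteMinOfLinear fun x : List (Positions V N) → ℝ =>
      γ ^ h.length * x h.pursuerSeq := fun h =>
    .of_linear ((γ ^ h.length) •
      ContinuousLinearMap.proj (R := ℝ) (φ := fun _ : List (Positions V N) => ℝ) h.pursuerSeq)
  induction n generalizing h with
  | zero =>
    by_cases hc : h.Caught sp₀
    · simpa [bestResponseUtility, hc] using hcaught h
    · simpa [bestResponseUtility, hc] using
        IsFiniteMinOfLinear.of_linear (0 : (List (Positions V N) → ℝ) →L[ℝ] ℝ)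
  | succ n ih =>
    by_cases hc : h.Caught sp₀
    · simpa [bestResponseUtility, hc] using hcaught h
    · obtain ⟨w, hw⟩ := hG h.evaderPos
      have : Nonempty {v // G.Adj h.evaderPos v} := ⟨⟨w, hw⟩⟩
      simp only [bestResponseUtility, hc, if_false]
      exact .iInf fun se => .sum _ fun sp => ih (h.extend sp se)

/-- Randomizing averages over her moves, and an average is at least the minimum. -/
theorem bestResponseUtility_le_planUtility {σ : History V N → V → ℝ}
    (hσ : σ ∈ evaderStrategies G N) (x : List (Positions V N) → ℝ) (n : ℕ) (h : History V N) :
    evaderPlan σ h * bestResponseUtility G γ sp₀ x n h ≤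
      planUtility γ sp₀ x (evaderPlan σ) n h := by
  induction n generalizing h with
  | zero =>
    simp only [planUtility, bestResponseUtility]
    split_ifs
    · exact le_of_eq (by ring)
    · simp
  | succ n ih =>
    simp only [planUtility, bestResponseUtility]
    split_ifs with hc
    · exact le_of_eq (by ring)
    set m := ⨅ se : {v // G.Adj h.evaderPos v},
      ∑ sp : Positions V N, bestResponseUtility G γ sp₀ x n (h.extend sp se)
    have hmove : ∀ se, σ h se * m ≤
        σ h se * ∑ sp : Positions V N, bestResponseUtility G γ sp₀ x n (h.extend sp se) := by
      intro se
      -- A nonadjacent vertex is outside the range of the infimum, but it has probability zero.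
      by_cases h0 : σ h se = 0
      · simp [h0]
      · exact mul_le_mul_of_nonneg_left
          (ciInf_le (f := fun se : {v // G.Adj h.evaderPos v} => ∑ sp : Positions V N,
            bestResponseUtility G γ sp₀ x n (h.extend sp se)) (Set.finite_range _).bddBelow
            ⟨se, (hσ h).2 se h0⟩) ((hσ h).1.1 se)
    calc evaderPlan σ h * m = evaderPlan σ h * ∑ se, σ h se * m := by
          rw [← Finset.sum_mul, (hσ h).1.2, one_mul]
      _ ≤ evaderPlan σ h * ∑ se, σ h se *
            ∑ sp : Positions V N, bestResponseUtility G γ sp₀ x n (h.extend sp se) :=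
          mul_le_mul_of_nonneg_left (Finset.sum_le_sum fun se _ => hmove se)
            ((isEvaderPlan_evaderPlan hσ).nonneg h)
      _ = ∑ sp : Positions V N, ∑ se, evaderPlan σ (h.extend sp se) *
            bestResponseUtility G γ sp₀ x n (h.extend sp se) := by
          simp_rw [evaderPlan_extend, Finset.mul_sum]
          rw [Finset.sum_comm]
          simp_rw [mul_assoc]
      _ ≤ _ := Finset.sum_le_sum fun sp _ => Finset.sum_le_sum fun se _ => ih _

/-- The evader has a strategy that is optimal against a given realization plan. -/
theorem exists_planUtility_eq_bestResponseUtility (hG : ∀ v, ∃ w, G.Adj v w)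
    (x : List (Positions V N) → ℝ) (t : ℕ) :
    ∃ σ ∈ evaderStrategies G N, ∀ n h, h.length + n = t →
      planUtility γ sp₀ x (evaderPlan σ) n h =
        evaderPlan σ h * bestResponseUtility G γ sp₀ x n h := by
  classical
  -- A strategy sees only the history, so the number of rounds left after the current one is
  -- recovered as `t - (h.length + 1)`.
  have hmin : ∀ h : History V N, ∃ c : {v // G.Adj h.evaderPos v},
      ∑ sp : Positions V N, bestResponseUtility G γ sp₀ x (t - (h.length + 1)) (h.extend sp c) =
        ⨅ se : {v // G.Adj h.evaderPos v}, ∑ sp : Positions V N,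
          bestResponseUtility G γ sp₀ x (t - (h.length + 1)) (h.extend sp se) := by
    intro h
    obtain ⟨w, hw⟩ := hG h.evaderPos
    have : Nonempty {v // G.Adj h.evaderPos v} := ⟨⟨w, hw⟩⟩
    exact exists_eq_ciInf_of_finite
  choose c hc using hmin
  refine ⟨_, single_mem_evaderStrategies (c := fun h => (c h).1) fun h => (c h).2, fun n => ?_⟩
  induction n with
  | zero =>
    intro h _
    simp only [planUtility, bestResponseUtility]
    split_ifs <;> ring
  | succ n ih =>
    intro h hn
    simp only [planUtility, bestResponseUtility]
    split_ifs
    · ring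
    · have hlen : t - (h.length + 1) = n := by omega
      rw [← hlen, ← hc h, hlen, Finset.mul_sum]
      refine Finset.sum_congr rfl fun sp _ => ?_
      rw [Finset.sum_congr rfl fun se _ => ih (h.extend sp se)
        (by rw [show (h.extend sp se).length = h.length + 1 from rfl]; omega)]
      simp_rw [evaderPlan_extend]
      rw [Finset.sum_eq_single (c h).1 (fun se _ hse => by simp [Pi.single_eq_of_ne hse])
        (fun hmem => absurd (Finset.mem_univ _) hmem)]
      simp

end Utility

/-! ### Equilibria, the value and the α-vectors -/

section Equilibrium

variable {V : Type*} [Fintype V] {N : ℕ} {G : Digraph V} {γ : ℝ} {sp₀ : Positions V N} {t : ℕ}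

theorem exists_isNashEquilibrium (hG : ∀ v, ∃ w, G.Adj v w) (b : V → ℝ) :
    ∃ σp σe, IsNashEquilibrium G γ t sp₀ b σp σe := by
  let u (y : History V N → ℝ) (x : List (Positions V N) → ℝ) : ℝ :=
    ∑ s, b s * planUtility γ sp₀ x y t ⟨s, []⟩
  have hright : ∀ x, ∃ φ : (History V N → ℝ) →L[ℝ] ℝ, ∀ y, u y x = φ y := fun x => by
    choose φ hφ using exists_linear_planUtility_right (γ := γ) (sp₀ := sp₀) x t
    exact ⟨∑ s, b s • φ ⟨s, []⟩, fun y => by simp [u, hφ, sum_apply]⟩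
  have hleft : ∀ y, ∃ φ : (List (Positions V N) → ℝ) →L[ℝ] ℝ, ∀ x, u y x = φ x := fun y => by
    choose φ hφ using exists_linear_planUtility_left (γ := γ) (sp₀ := sp₀) y t
    exact ⟨∑ s, b s • φ ⟨s, []⟩, fun y => by simp [u, hφ, sum_apply]⟩
  choose φ hφ using hright
  choose ψ hψ using hleft
  obtain ⟨τe, hτe⟩ := evaderStrategies_nonempty (N := N) hG
  obtain ⟨τp, hτp⟩ := pursuerStrategies_nonempty (sp₀ := sp₀) hG
  -- The evader minimizes in the first argument, the pursuer maximizes in the second.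
  obtain ⟨y, hy, x, hx, hsaddle⟩ := Sion.exists_isSaddlePointOn
    (X := evaderPlans G N) (Y := pursuerPlans G sp₀ t) (f := u)
    ⟨_, isEvaderPlan_evaderPlan hτe⟩ convex_evaderPlans isCompact_evaderPlans
    (fun x _ => by
      simp only [hφ]
      exact (φ x).continuous.lowerSemicontinuous.lowerSemicontinuousOn _)
    (fun x _ => by
      simp only [hφ]
      exact ((φ x).toLinearMap.convexOn convex_evaderPlans).quasiconvexOn)
    convex_pursuerPlans ⟨_, pursuerPlan_mem hτp⟩ isCompact_pursuerPlans
    (fun y _ => by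
      simp only [hψ]
      exact (ψ y).continuous.upperSemicontinuous.upperSemicontinuousOn _)
    (fun y _ => by
      simp only [hψ]
      exact ((ψ y).toLinearMap.concaveOn convex_pursuerPlans).quasiconcaveOn)
  obtain ⟨σe, hσe, rfl⟩ := exists_evaderPlan_eq hG sp₀ hy
  obtain ⟨σp, hσp, rfl⟩ := exists_pursuerPlan_eq hG hx
  refine ⟨σp, σe, hσp, hσe, fun σp' hσp' => ?_, fun σe' hσe' => ?_⟩
  · rw [expectedUtility_eq_planUtility, expectedUtility_eq_planUtility]
    exact hsaddle _ hy _ (pursuerPlan_mem hσp')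
  · rw [expectedUtility_eq_planUtility, expectedUtility_eq_planUtility]
    exact hsaddle _ (isEvaderPlan_evaderPlan hσe') _ hx

/-- Exchange: pairing the pursuer's strategy of one equilibrium with the evader's of the other gives
a utility between the two equilibrium utilities, in either order. -/
theorem IsNashEquilibrium.expectedUtility_eq {b : V → ℝ}
    {σp σp' : List (Positions V N) → Positions V N → ℝ} {σe σe' : History V N → V → ℝ}
    (h : IsNashEquilibrium G γ t sp₀ b σp σe) (h' : IsNashEquilibrium G γ t sp₀ b σp' σe') :
    expectedUtility γ t sp₀ b σp σe = expectedUtility γ t sp₀ b σp' σe' :=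
  le_antisymm
    ((h.evader_best _ h'.evader_mem).trans (h'.pursuer_best _ h.pursuer_mem))
    ((h'.evader_best _ h.evader_mem).trans (h.pursuer_best _ h'.pursuer_mem))

theorem existsUnique_isGameValue (hG : ∀ v, ∃ w, G.Adj v w) (b : V → ℝ) :
    ∃! v, IsGameValue G γ t sp₀ b v := by
  obtain ⟨σp, σe, h⟩ := exists_isNashEquilibrium (γ := γ) (t := t) (sp₀ := sp₀) hG b
  refine ⟨_, ⟨σp, σe, h, rfl⟩, ?_⟩
  rintro _ ⟨σp', σe', h', rfl⟩
  exact h'.expectedUtility_eq h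

theorem isGameValue_valueFunction (hG : ∀ v, ∃ w, G.Adj v w) (b : V → ℝ) :
    IsGameValue G γ t sp₀ b (valueFunction G γ t sp₀ b) := by
  have h := (existsUnique_isGameValue (γ := γ) (t := t) (sp₀ := sp₀) hG b).exists
  rw [valueFunction, dif_pos h]
  exact h.choose_spec

/-- The value of the game is what the pursuer secures with his best realization plan. -/
theorem isGreatest_valueFunction (hG : ∀ v, ∃ w, G.Adj v w) {b : V → ℝ} (hb : ∀ v, 0 ≤ b v) :
    IsGreatest ((fun x => ∑ s, b s * bestResponseUtility G γ sp₀ x t ⟨s, []⟩) ''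
      pursuerPlans G sp₀ t) (valueFunction G γ t sp₀ b) := by
  have hle : ∀ x, ∀ σ ∈ evaderStrategies G N,
      ∑ s, b s * bestResponseUtility G γ sp₀ x t ⟨s, []⟩ ≤
        ∑ s, b s * planUtility γ sp₀ x (evaderPlan σ) t ⟨s, []⟩ := fun x σ hσ =>
    Finset.sum_le_sum fun s _ => mul_le_mul_of_nonneg_left
      (by simpa [evaderPlan_start] using bestResponseUtility_le_planUtility (γ := γ) (sp₀ := sp₀) hσ x t ⟨s, []⟩) (hb s)
  obtain ⟨σp, σe, hNash, hval⟩ := isGameValue_valueFunction (γ := γ) (t := t) (sp₀ := sp₀) hG b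
  have hupper : ∀ x ∈ pursuerPlans G sp₀ t,
      ∑ s, b s * bestResponseUtility G γ sp₀ x t ⟨s, []⟩ ≤ valueFunction G γ t sp₀ b := by
    intro x hx
    obtain ⟨σ, hσ, rfl⟩ := exists_pursuerPlan_eq hG hx
    refine (hle _ σe hNash.evader_mem).trans ?_
    rw [← expectedUtility_eq_planUtility, ← hval]
    exact hNash.pursuer_best σ hσ
  refine ⟨⟨_, pursuerPlan_mem hNash.pursuer_mem,
    le_antisymm (hupper _ (pursuerPlan_mem hNash.pursuer_mem)) ?_⟩, ?_⟩
  -- The equilibrium plan attains the bound: deviating to a best reply against it cannot lower the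
  -- utility below the value.
  · obtain ⟨σ, hσ, hopt⟩ := exists_planUtility_eq_bestResponseUtility
      (γ := γ) (sp₀ := sp₀) hG (pursuerPlan t σp) t
    rw [← hval]
    refine (hNash.evader_best σ hσ).trans_eq ?_
    rw [expectedUtility_eq_planUtility]
    refine Finset.sum_congr rfl fun s _ => ?_
    rw [hopt t ⟨s, []⟩ (Nat.zero_add t), evaderPlan_start, one_mul]
  · rintro _ ⟨x, hx, rfl⟩
    exact hupper x hx

/-- The value function is a maximum of finitely many linear functions of the belief. -/
theorem exists_alphaVectors (hG : ∀ v, ∃ w, G.Adj v w) (γ : ℝ) (t : ℕ) (sp₀ : Positions V N) :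
    ∃ (A : Finset (V → ℝ)) (hA : A.Nonempty), ∀ b ∈ stdSimplex ℝ V,
      valueFunction G γ t sp₀ b = A.sup' hA (fun α => ∑ v, α v * b v) := by
  classical
  have hfin : Finite {l : List (Positions V N) // l.length ≤ t} :=
    (List.finite_length_le (Positions V N) t).to_subtype
  obtain ⟨A, hAfin, hAsub, hA⟩ := exists_finite_maximizers
    (fun l : {l : List (Positions V N) // l.length ≤ t} =>
      ContinuousLinearMap.proj (R := ℝ) (φ := fun _ => ℝ) l.1)
    (M := {x | IsPursuerFlow G sp₀ t x}) (fun x hx y hy c => hx.add_smul_sub hy c)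
    (isCompact_pursuerPlans (G := G) (sp₀ := sp₀) (t := t))
    (f := fun s x => bestResponseUtility G γ sp₀ x t ⟨s, []⟩)
    fun s => isFiniteMinOfLinear_bestResponseUtility hG t ⟨s, []⟩
  lift A to Finset (List (Positions V N) → ℝ) using hAfin
  have hAne : A.Nonempty := by
    obtain ⟨τ, hτ⟩ := pursuerStrategies_nonempty (sp₀ := sp₀) hG
    -- The weight 0 is arbitrary; only the existence of an element of `A` is needed.
    obtain ⟨a, ha, -⟩ := hA _ (pursuerPlan_mem hτ).1 (pursuerPlan_mem (t := t) hτ).2 0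
    exact ⟨a, ha⟩
  let α (x : List (Positions V N) → ℝ) (s : V) : ℝ := bestResponseUtility G γ sp₀ x t ⟨s, []⟩
  have hα : ∀ x (b : V → ℝ), ∑ v, α x v * b v = ∑ s, b s * bestResponseUtility G γ sp₀ x t ⟨s, []⟩ :=
    fun x b => Finset.sum_congr rfl fun s _ => mul_comm _ _
  refine ⟨A.image α, hAne.image α, fun b hb => ?_⟩
  obtain ⟨⟨x, hx, hxval⟩, hupper⟩ :=
    isGreatest_valueFunction (γ := γ) (t := t) (sp₀ := sp₀) hG hb.1
  apply le_antisymm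
  · obtain ⟨a, ha, hle⟩ := hA x hx.1 hx.2 b
    rw [← hxval]
    refine hle.trans ?_
    rw [← hα]
    exact Finset.le_sup' (fun α : V → ℝ => ∑ v, α v * b v) (Finset.mem_image_of_mem α ha)
  · refine Finset.sup'_le _ _ fun β hβ => ?_
    obtain ⟨a, ha, rfl⟩ := Finset.mem_image.1 hβ
    rw [hα]
    exact hupper ⟨a, hAsub ha, rfl⟩

end Equilibrium

end PursuitEvasion

theorem theorem2 {V : Type*} [Fintype V] (G : Digraph V) (hG : ∀ v, ∃ w, G.Adj v w)
    (N : ℕ) (γ : ℝ) (hγ₀ : 0 ≤ γ) (hγ₁ : γ < 1) (t : ℕ) (sp₀ : PursuitEvasion.Positions V N) :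
    (∀ b ∈ stdSimplex ℝ V, ∃! v, PursuitEvasion.IsGameValue G γ t sp₀ b v) ∧
    PursuitEvasion.PiecewiseLinearOn (stdSimplex ℝ V)
      (PursuitEvasion.valueFunction G γ t sp₀) ∧
    ConvexOn ℝ (stdSimplex ℝ V) (PursuitEvasion.valueFunction G γ t sp₀) ∧
    ∃ (A : Finset (V → ℝ)) (hA : A.Nonempty), ∀ b ∈ stdSimplex ℝ V,
      PursuitEvasion.valueFunction G γ t sp₀ b = A.sup' hA (fun α => ∑ v, α v * b v) := by
  obtain ⟨A, hA, h⟩ := PursuitEvasion.exists_alphaVectors hG γ t sp₀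
  exact ⟨fun b _ => PursuitEvasion.existsUnique_isGameValue hG b,
    PursuitEvasion.piecewiseLinearOn_of_eq_sup' hA h, PursuitEvasion.convexOn_of_eq_sup' hA h,
    A, hA, h⟩
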